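/- Let $(M,\tau)$ be a diffuse tracial von Neumann algebra: $M$ is a von Neumann algebra on a Hilbert space without minimal projections, and $\tau$ is a faithful normal tracial state on $M$; write $\|x\|_2=\tau(x^*x)^{1/2}$. Let $\mathcal U$ be a countably cofinal ultrafilter on a set $S$, i.e. there are sets $B_1,B_2,\ldots\in\mathcal U$ with $\bigcap_n B_n=\emptyset$ (for instance, a free ultrafilter on $\mathbb N$). Let $M^{\mathcal U}=\ell^\infty(S,M)/\{(x_s)_s:\lim_{s\to\mathcal U}\|x_s\|_2=0\}$ be the tracial ultrapower, with trace $\tau_{\mathcal U}([x_s])=\lim_{s\to\mathcal U}\tau(x_s)$, and regard $M$ as a subalgebra of $M^{\mathcal U}$ through the diagonal embedding. For $N=M$ or $N=M^{\mathcal U}$ let $\mathcal H(N)$ be the set of Haar unitaries of $N$, i.e. the unitaries $u\in N$ all of whose powers $u^n$, $n\ge 1$, have trace $0$. For $u,v\in\mathcal H(M)$ write $u\sim_M v$ if there are $n\ge1$ and $w_1,\ldots,w_n\in\mathcal H(M^{\mathcal U})$ with $[u,w_1]=[w_k,w_{k+1}]=[w_n,v]=0$ for all $1\le k<n$. Let $p_M(u,v)\in\{0,1,2,\ldots,\infty\}$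 be the least $k\ge 0$ such that there are $u=w_0,w_1,\ldots,w_k=v$ in $\mathcal H(M^{\mathcal U})$ with $[w_i,w_{i+1}]=0$ for all $0\le i<k$, and $p_M(u,v)=\infty$ if there is no such $k$. Let $\mathfrak R(M)$ be the supremum, over all classes $\mathcal O$ of $\sim_M$, of $\sup_{u,v\in\mathcal O}p_M(u,v)$. Then $\sim_M$ is an equivalence relation on $\mathcal H(M)$. Moreover, if $\mathcal H(M)$ carries the strong operator topology, and likewise if it carries the topology of $\|\cdot\|_2$, and $\mathcal H(M)\times\mathcal H(M)$ carries the product topology, then: 1. for every integer $k\ge0$ the set $\{(u,v)\in\mathcal H(M)\times\mathcal H(M):p_M(u,v)\le k\}$ is closed; 2. $\sim_M$ is an $F_\sigma$ subset of $\mathcal H(M)\times\mathcal H(M)$; 3. $\sim_M$ is a Borel subset of $\mathcal H(M)\times\mathcal H(M)$; 4. if $\mathfrak R(M)<\infty$, then $\sim_M$ is closed in $\mathcal H(M)\times\mathcal H(M)$. -/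

import Mathlib

open Filter Topology

noncomputable section

namespace TracialVN

/-! ### Tracial states and the 2-norm -/

/-- A faithful tracial state on a unital C*-algebra. -/
structure FaithfulTracialState (A : Type*) [CStarAlgebra A] extends A →ₗ[ℂ] ℂ where
  map_one' : toFun 1 = 1
  nonneg' : ∀ x : A, 0 ≤ (toFun (star x * x)).re ∧ (toFun (star x * x)).im = 0
  trace' : ∀ x y : A, toFun (x * y) = toFun (y * x)
  faithful' : ∀ x : A, toFun (star x * x) = 0 → x = 0

instance {A : Type*} [CStarAlgebra A] : CoeFun (FaithfulTracialState A) (fun _ => A → ℂ) where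
  coe τ := τ.toLinearMap

section TwoNorm

variable {A : Type*} [CStarAlgebra A] (τ : FaithfulTracialState A)

/-- `‖x‖₂ = τ(x* x)^{1/2}`. -/
def twoNorm (x : A) : ℝ := Real.sqrt (τ (star x * x)).re

theorem tr_comm (x y : A) : τ (x * y) = τ (y * x) := τ.trace' x y

theorem tr_nonneg (x : A) : 0 ≤ (τ (star x * x)).re := (τ.nonneg' x).1

theorem twoNorm_nonneg (x : A) : 0 ≤ twoNorm τ x := Real.sqrt_nonneg _

theorem twoNorm_sq (x : A) : twoNorm τ x ^ 2 = (τ (star x * x)).re :=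
  Real.sq_sqrt (tr_nonneg τ x)

theorem twoNorm_zero : twoNorm τ 0 = 0 := by simp [twoNorm]

theorem twoNorm_neg (x : A) : twoNorm τ (-x) = twoNorm τ x := by simp [twoNorm]

theorem twoNorm_star (x : A) : twoNorm τ (star x) = twoNorm τ x := by
  simp only [twoNorm, star_star]
  rw [tr_comm]

theorem twoNorm_add_sq_le (x y : A) :
    twoNorm τ (x + y) ^ 2 ≤ 2 * twoNorm τ x ^ 2 + 2 * twoNorm τ y ^ 2 := by
  have h := tr_nonneg τ (x - y)
  simp only [twoNorm_sq]
  simp only [star_add, star_sub, add_mul, mul_add, sub_mul, mul_sub, map_add, map_sub,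
    Complex.add_re, Complex.sub_re] at h ⊢
  linarith

theorem twoNorm_mul_le (x y : A) : twoNorm τ (x * y) ≤ ‖x‖ * twoNorm τ y := by
  let _ : PartialOrder A := CStarAlgebra.spectralOrder A
  have _ : StarOrderedRing A := CStarAlgebra.spectralOrderedRing A
  have h1 : star y * (star x * x) * y ≤ ‖star x * x‖ • (star y * y) :=
    CStarAlgebra.star_left_conjugate_le_norm_smul
  obtain ⟨z, hz⟩ := CStarAlgebra.nonneg_iff_eq_star_mul_self.1 (sub_nonneg.2 h1)
  have h2 := tr_nonneg τ z
  rw [← hz, map_sub, Complex.sub_re, CStarRing.norm_star_mul_self,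
    ← Complex.coe_smul, map_smul, Complex.coe_smul, Complex.smul_re, smul_eq_mul] at h2
  have h3 : twoNorm τ (x * y) ^ 2 ≤ (‖x‖ * twoNorm τ y) ^ 2 := by
    rw [mul_pow, twoNorm_sq, twoNorm_sq, star_mul]
    have : star y * star x * (x * y) = star y * (star x * x) * y := by
      simp only [mul_assoc]
    rw [this]
    nlinarith
  exact le_of_sq_le_sq h3 (mul_nonneg (norm_nonneg _) (twoNorm_nonneg τ y))

theorem twoNorm_mul_le' (x y : A) : twoNorm τ (x * y) ≤ ‖y‖ * twoNorm τ x := by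
  rw [← twoNorm_star τ (x * y), star_mul, ← twoNorm_star τ x, ← norm_star y]
  exact twoNorm_mul_le τ _ _

theorem norm_tr_le (x : A) : ‖τ x‖ ≤ twoNorm τ x := by
  set c : ℂ := τ x with hc
  have hone : τ (1 : A) = 1 := τ.map_one'
  -- positivity at `x - τ(x) 1`
  have h := tr_nonneg τ (x - c • 1)
  have h0 := τ.nonneg' (x + 1)
  have h1 := τ.nonneg' (x + (Complex.I • 1 : A))
  have e0 := h0.2
  have e1 := h1.2
  have ex := (τ.nonneg' x).2
  change (τ (star (x + 1) * (x + 1))).im = 0 at e0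
  change (τ (star (x + (Complex.I • 1 : A)) * (x + (Complex.I • 1 : A)))).im = 0 at e1
  change (τ (star x * x)).im = 0 at ex
  simp only [star_add, star_sub, star_smul, star_one, add_mul, mul_add, sub_mul, mul_sub, map_add,
    map_sub, map_smul, smul_mul_assoc, mul_smul_comm, one_mul, mul_one, smul_eq_mul, hone,
    ← hc, RCLike.star_def, Complex.sub_re, Complex.add_im, Complex.mul_re,
    Complex.mul_im, Complex.conj_re, Complex.conj_im, Complex.I_re, Complex.I_im,
    Complex.one_im] at h e0 e1
  have hsq : ‖c‖ ^ 2 ≤ twoNorm τ x ^ 2 := by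
    rw [twoNorm_sq, ← Complex.normSq_eq_norm_sq, Complex.normSq_apply]
    have r1 : (τ (star x)).re = c.re := by linarith
    have r2 : (τ (star x)).im = - c.im := by linarith
    rw [r1, r2] at h
    linarith
  exact le_of_sq_le_sq hsq (twoNorm_nonneg τ x)

end TwoNorm

/-! ### The tracial ultrapower -/

section Ultrapower

variable (S A : Type*) [CStarAlgebra A]

/-- `ℓ^∞(S, A)`: the norm-bounded families, with pointwise operations. -/
def boundedFamilies : StarSubalgebra ℂ (S → A) where
  carrier := {x | ∃ C : ℝ, ∀ s, ‖x s‖ ≤ C}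
  mul_mem' := by
    rintro x y ⟨C, hC⟩ ⟨D, hD⟩
    exact ⟨C * D, fun s => (norm_mul_le _ _).trans
      (mul_le_mul (hC s) (hD s) (norm_nonneg _) ((norm_nonneg _).trans (hC s)))⟩
  add_mem' := by
    rintro x y ⟨C, hC⟩ ⟨D, hD⟩
    exact ⟨C + D, fun s => (norm_add_le _ _).trans (add_le_add (hC s) (hD s))⟩
  algebraMap_mem' := fun r => ⟨‖algebraMap ℂ A r‖, fun _ => le_rfl⟩
  star_mem' := by
    rintro x ⟨C, hC⟩
    exact ⟨C, fun s => by simpa using hC s⟩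

variable {S A} (𝒰 : Ultrafilter S) (τ : FaithfulTracialState A)

/-- The ideal of the bounded families with `lim_{s → 𝒰} ‖x_s‖₂ = 0`. -/
def nullIdeal : Ideal (boundedFamilies S A) where
  carrier := {x | Tendsto (fun s => twoNorm τ (x.1 s)) 𝒰 (𝓝 0)}
  zero_mem' := by
    change Tendsto (fun _ : S => twoNorm τ (0 : A)) 𝒰 (𝓝 0)
    rw [twoNorm_zero]
    exact tendsto_const_nhds
  add_mem' := by
    intro x y hx hy
    have h1 : Tendsto (fun s => Real.sqrt (2 * twoNorm τ (x.1 s) ^ 2 + 2 * twoNorm τ (y.1 s) ^ 2))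
        𝒰 (𝓝 0) := by
      have := (((hx.pow 2).const_mul 2).add ((hy.pow 2).const_mul 2)).sqrt
      simpa using this
    refine squeeze_zero (fun s => twoNorm_nonneg τ _) (fun s => ?_) h1
    exact Real.le_sqrt_of_sq_le (twoNorm_add_sq_le τ _ _)
  smul_mem' := by
    intro c x hx
    obtain ⟨C, hC⟩ := c.2
    have h1 : Tendsto (fun s => C * twoNorm τ (x.1 s)) 𝒰 (𝓝 0) := by
      simpa using Tendsto.const_mul C hx
    refine squeeze_zero (fun s => twoNorm_nonneg τ _) (fun s => ?_) h1
    exact (twoNorm_mul_le τ _ _).trans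
      (mul_le_mul_of_nonneg_right (hC s) (twoNorm_nonneg τ _))

theorem mem_nullIdeal {x : boundedFamilies S A} :
    x ∈ nullIdeal 𝒰 τ ↔ Tendsto (fun s => twoNorm τ (x.1 s)) 𝒰 (𝓝 0) := Iff.rfl

instance : (nullIdeal 𝒰 τ).IsTwoSided where
  mul_mem_of_left := by
    intro x y hx
    obtain ⟨C, hC⟩ := y.2
    have h1 : Tendsto (fun s => C * twoNorm τ (x.1 s)) 𝒰 (𝓝 0) := by
      simpa using Tendsto.const_mul C hx
    refine squeeze_zero (fun s => twoNorm_nonneg τ _) (fun s => ?_) h1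
    exact (twoNorm_mul_le' τ _ _).trans
      (mul_le_mul_of_nonneg_right (hC s) (twoNorm_nonneg τ _))

theorem star_mem_nullIdeal {x : boundedFamilies S A} (hx : x ∈ nullIdeal 𝒰 τ) :
    star x ∈ nullIdeal 𝒰 τ := by
  rw [mem_nullIdeal] at hx ⊢
  refine hx.congr fun s => ?_
  exact (twoNorm_star τ _).symm

/-- The tracial ultrapower `A^𝒰 = ℓ^∞(S, A) / {x : lim_{s → 𝒰} ‖x_s‖₂ = 0}`. -/
abbrev Ultrapower : Type _ := boundedFamilies S A ⧸ nullIdeal 𝒰 τ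

/-- The involution of the ultrapower, `[x]* = [x*]`. -/
instance : StarRing (Ultrapower 𝒰 τ) where
  star := Quotient.map' star (by
    intro x y h
    rw [Submodule.quotientRel_def] at h ⊢
    have h' := star_mem_nullIdeal 𝒰 τ h
    rwa [star_sub] at h')
  star_involutive := by
    rintro ⟨x⟩
    exact congrArg (Ideal.Quotient.mk (nullIdeal 𝒰 τ)) (star_star x)
  star_mul := by
    rintro ⟨x⟩ ⟨y⟩
    exact congrArg (Ideal.Quotient.mk (nullIdeal 𝒰 τ)) (star_mul x y)
  star_add := by
    rintro ⟨x⟩ ⟨y⟩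
    exact congrArg (Ideal.Quotient.mk (nullIdeal 𝒰 τ)) (star_add x y)

/-- The trace of the ultrapower, `τ_𝒰([x]) = lim_{s → 𝒰} τ(x_s)`. The limit exists because
`(τ(x_s))_s` is bounded. -/
def ultraTrace (x : Ultrapower 𝒰 τ) : ℂ :=
  Quotient.liftOn' x (fun y => limUnder (𝒰 : Filter S) (fun s => τ (y.1 s))) (by
    intro x y h
    rw [Submodule.quotientRel_def, mem_nullIdeal] at h
    have hd : Tendsto (fun s => τ (x.1 s) - τ (y.1 s)) 𝒰 (𝓝 0) := by
      refine squeeze_zero_norm (fun s => ?_) h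
      rw [← map_sub]
      exact norm_tr_le τ _
    have key : ∀ a : ℂ, Tendsto (fun s => τ (x.1 s)) 𝒰 (𝓝 a) ↔
        Tendsto (fun s => τ (y.1 s)) 𝒰 (𝓝 a) := by
      intro a
      constructor
      · intro hx
        simpa using hx.sub hd
      · intro hy
        simpa using hy.add hd
    change Classical.epsilon _ = Classical.epsilon _
    congr 1
    funext a
    exact propext (key a))

/-- The diagonal embedding `ι : A → A^𝒰`. -/
def diag (x : A) : Ultrapower 𝒰 τ :=
  Ideal.Quotient.mk (nullIdeal 𝒰 τ) ⟨fun _ => x, ‖x‖, fun _ => le_rfl⟩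

end Ultrapower

/-- An ultrafilter is countably cofinal if it contains a sequence of sets with empty
intersection. -/
def IsCountablyCofinal {S : Type*} (𝒰 : Ultrafilter S) : Prop :=
  ∃ B : ℕ → Set S, (∀ n, B n ∈ 𝒰) ∧ ⋂ n, B n = ∅

/-! ### Haar unitaries, sequential commutation, path length -/

/-- `u` is a Haar unitary with respect to the functional `φ`. -/
def IsHaarUnitary {B : Type*} [Ring B] [StarRing B] (φ : B → ℂ) (u : B) : Prop :=
  u ∈ unitary B ∧ ∀ n : ℕ, 1 ≤ n → φ (u ^ n) = 0

section Paths

variable {S A : Type*} [CStarAlgebra A] (𝒰 : Ultrafilter S) (τ : FaithfulTracialState A)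

/-- The set `ℋ(A)` of Haar unitaries of `(A, τ)`. -/
def HaarUnitaries : Type _ := {u : A // IsHaarUnitary τ u}

/-- `u ∼ v`: there are Haar unitaries `w₀, …, w_n` (with `n ≥ 0`) in `A^𝒰` such that
`[u, w₀] = [w_k, w_{k+1}] = [w_n, v] = 0`. -/
def SeqCommute (u v : HaarUnitaries τ) : Prop :=
  ∃ (n : ℕ) (w : Fin (n + 1) → Ultrapower 𝒰 τ),
    (∀ i, IsHaarUnitary (ultraTrace 𝒰 τ) (w i)) ∧
    Commute (diag 𝒰 τ u.1) (w 0) ∧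
    (∀ i : Fin n, Commute (w i.castSucc) (w i.succ)) ∧
    Commute (w (Fin.last n)) (diag 𝒰 τ v.1)

/-- There is a commutator path with `k` steps from `u` to `v`: Haar unitaries
`u = w₀, w₁, …, w_k = v` in `A^𝒰` with `[w_i, w_{i+1}] = 0`. -/
def HasPath (u v : HaarUnitaries τ) (k : ℕ) : Prop :=
  ∃ w : Fin (k + 1) → Ultrapower 𝒰 τ,
    (∀ i, IsHaarUnitary (ultraTrace 𝒰 τ) (w i)) ∧
    w 0 = diag 𝒰 τ u.1 ∧ w (Fin.last k) = diag 𝒰 τ v.1 ∧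
    ∀ i : Fin k, Commute (w i.castSucc) (w i.succ)

/-- The path length `p(u, v) ∈ {0, 1, …, ∞}`: the least number of steps of a commutator path in
`A^𝒰` from `u` to `v`, and `∞` if there is none. -/
def pathLength (u v : HaarUnitaries τ) : ℕ∞ :=
  ⨅ (k : ℕ) (_ : HasPath 𝒰 τ u v k), (k : ℕ∞)

/-- The orbit of `u`. -/
def orbit (u : HaarUnitaries τ) : Set (HaarUnitaries τ) := {v | SeqCommute 𝒰 τ v u}

/-- The largest path length between two elements of the set `O`. -/
def orbitDiameter (O : Set (HaarUnitaries τ)) : ℕ∞ :=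
  ⨆ (u ∈ O) (v ∈ O), pathLength 𝒰 τ u v

/-- The commutation diameter: the supremum over all orbits of their diameters. -/
def commutationDiameter : ℕ∞ :=
  ⨆ u : HaarUnitaries τ, orbitDiameter 𝒰 τ (orbit 𝒰 τ u)

/-- The topology of `‖·‖₂` on the Haar unitaries: `U` is open if it contains with every point a
`‖·‖₂`-ball around it. -/
abbrev twoNormTopology : TopologicalSpace (HaarUnitaries τ) where
  IsOpen U := ∀ u ∈ U, ∃ ε > 0, ∀ v : HaarUnitaries τ, twoNorm τ (v.1 - u.1) < ε → v ∈ U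
  isOpen_univ := fun _ _ => ⟨1, one_pos, fun _ _ => trivial⟩
  isOpen_inter := by
    rintro U V hU hV u ⟨h1, h2⟩
    obtain ⟨ε, hε, hεU⟩ := hU u h1
    obtain ⟨δ, hδ, hδV⟩ := hV u h2
    exact ⟨min ε δ, lt_min hε hδ, fun v hv =>
      ⟨hεU v (hv.trans_le (min_le_left _ _)), hδV v (hv.trans_le (min_le_right _ _))⟩⟩
  isOpen_sUnion := by
    rintro 𝒮 h u ⟨U, hU, hu⟩
    obtain ⟨ε, hε, hεU⟩ := h U hU u hu
    exact ⟨ε, hε, fun v hv => ⟨U, hU, hεU v hv⟩⟩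

end Paths

/-! ### Von Neumann algebras -/

section VN

variable {H : Type*} [NormedAddCommGroup H] [InnerProductSpace ℂ H] [CompleteSpace H]

/-- A von Neumann algebra is norm closed, hence a C*-algebra. -/
instance (M : VonNeumannAlgebra H) : CStarAlgebra M.toStarSubalgebra :=
  StarSubalgebra.cstarAlgebra M.toStarSubalgebra (h_closed := by
    have h := Set.isClosed_centralizer (Set.centralizer (M : Set (H →L[ℂ] H)))
    rw [M.centralizer_centralizer] at h
    exact h)

/-- `τ` is normal, i.e. σ-weakly continuous: it belongs to the predual of `M`, which consists of
the functionals `x ↦ ∑ₙ ⟪ξₙ, x ηₙ⟫` with square summable sequences of vectors. -/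
def IsNormal (M : VonNeumannAlgebra H) (τ : FaithfulTracialState M.toStarSubalgebra) : Prop :=
  ∃ ξ η : ℕ → H, Summable (fun n => ‖ξ n‖ ^ 2) ∧ Summable (fun n => ‖η n‖ ^ 2) ∧
    ∀ x : M.toStarSubalgebra, HasSum (fun n => inner ℂ (ξ n) ((x : H →L[ℂ] H) (η n))) (τ x)

/-- `M` is diffuse: it has no minimal projections, i.e. every nonzero projection of `M` has a
subprojection in `M` different from itself and from `0`. -/
def IsDiffuse (M : VonNeumannAlgebra H) : Prop :=
  ∀ p ∈ M, IsStarProjection p → p ≠ 0 →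
    ∃ q ∈ M, IsStarProjection q ∧ p * q = q ∧ q ≠ 0 ∧ q ≠ p

/-- The strong operator topology on the Haar unitaries of `M`. -/
abbrev strongOperatorTopology (M : VonNeumannAlgebra H)
    (τ : FaithfulTracialState M.toStarSubalgebra) : TopologicalSpace (HaarUnitaries τ) :=
  TopologicalSpace.induced (fun (u : HaarUnitaries τ) (ξ : H) => (u.1 : H →L[ℂ] H) ξ)
    Pi.topologicalSpace

end VN

/-- `F` is an `F_σ` set: a countable union of closed sets. -/
def IsFSigma {X : Type*} [TopologicalSpace X] (F : Set X) : Prop :=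
  ∃ C : ℕ → Set X, (∀ n, IsClosed (C n)) ∧ F = ⋃ n, C n

end TracialVN

end

/-!
The relation `∼` is the relation of being joined by a commutator path of some length, and paths may
be lengthened by repeating their last point. So everything reduces to the closedness, for each `k`,
of the set of pairs joined by a path with `k` steps.

This holds because the existence of such a path in the ultrapower is a condition on finite tuples of
`A` itself (`hasPath_iff_approxPath`): for every `ε > 0` and every `m` there is a tuple in the unit
ball of `A` that satisfies the defining relations of a path up to `ε` in `‖·‖₂`, with the trace
condition required only for the powers up to `m`. From a path one gets such tuples by lifting its
points to families of contractions and evaluating at a suitable index; a unitary `[x_s]` lifts to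
contractions because `x` may be replaced by `2 x (1 + x* x)⁻¹` (`exists_norm_le_one_twoNorm_sub_le`).
Conversely, countable cofinality provides a map `S → ℕ` that tends to infinity along the ultrafilter
(`IsCountablyCofinal.exists_tendsto_atTop`), and this turns a sequence of better and better tuples
into a path.

The approximate condition is stable under small `‖·‖₂`-perturbations of the endpoints, hence closed in
every topology in which `‖·‖₂`-balls are neighbourhoods. For the strong operator topology this last
property is where the normality of the trace enters: `v ↦ ‖v - u‖₂²` is a uniformly convergent series
of strongly continuous functions on the unitaries.
-/

namespace TracialVN

/-! ### The 2-norm -/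

section TwoNorm

variable {A : Type*} [CStarAlgebra A] (τ : FaithfulTracialState A)

theorem twoNorm_one : twoNorm τ 1 = 1 := by
  have h : τ (1 : A) = 1 := τ.map_one'
  simp [twoNorm, h]

theorem twoNorm_le_norm (x : A) : twoNorm τ x ≤ ‖x‖ := by
  simpa [twoNorm_one] using twoNorm_mul_le τ x 1

theorem norm_tr_le_norm (x : A) : ‖τ x‖ ≤ ‖x‖ :=
  (norm_tr_le τ x).trans (twoNorm_le_norm τ x)

theorem eq_zero_of_twoNorm_eq_zero {x : A} (h : twoNorm τ x = 0) : x = 0 := by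
  refine τ.faithful' x (Complex.ext ?_ (τ.nonneg' x).2)
  have := twoNorm_sq τ x
  rw [h] at this
  simpa using this.symm

/-- The triangle inequality, from the positivity of `τ (z* z)` at `z = ‖y‖₂ x - ‖x‖₂ y`. -/
theorem twoNorm_add_le (x y : A) : twoNorm τ (x + y) ≤ twoNorm τ x + twoNorm τ y := by
  rcases (twoNorm_nonneg τ x).eq_or_lt with hx | hx
  · rw [eq_zero_of_twoNorm_eq_zero τ hx.symm]
    simp [twoNorm_zero]
  rcases (twoNorm_nonneg τ y).eq_or_lt with hy | hy
  · rw [eq_zero_of_twoNorm_eq_zero τ hy.symm]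
    simp [twoNorm_zero]
  set a := twoNorm τ x with ha
  set b := twoNorm τ y with hb
  have h := tr_nonneg τ ((b : ℂ) • x - (a : ℂ) • y)
  have hxx := twoNorm_sq τ x
  have hyy := twoNorm_sq τ y
  rw [← ha] at hxx
  rw [← hb] at hyy
  simp only [star_sub, star_smul, sub_mul, mul_sub, map_sub, map_smul, smul_mul_assoc,
    mul_smul_comm, smul_eq_mul, RCLike.star_def, Complex.conj_ofReal, Complex.sub_re,
    Complex.re_ofReal_mul] at h
  rw [← hxx, ← hyy] at h
  refine le_of_sq_le_sq ?_ (add_nonneg hx.le hy.le)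
  rw [twoNorm_sq]
  simp only [star_add, add_mul, mul_add, map_add, Complex.add_re]
  rw [← hxx, ← hyy]
  have h' : 0 ≤ (a * b) * (2 * a * b - ((τ (star x * y)).re + (τ (star y * x)).re)) := by
    linarith
  have := nonneg_of_mul_nonneg_right h' (mul_pos hx hy)
  linarith

/-- If `x` is nearly an isometry in `‖·‖₂`, then it is near a contraction in `‖·‖₂`, namely
`2 x (1 + x* x)⁻¹`. -/
theorem exists_norm_le_one_twoNorm_sub_le (x : A) :
    ∃ y : A, ‖y‖ ≤ 1 ∧ twoNorm τ (x - y) ≤ ‖x‖ * twoNorm τ (star x * x - 1) := by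
  set t := star x * x with ht
  have hsa : IsSelfAdjoint t := IsSelfAdjoint.star_mul_self x
  have hpos : ∀ a ∈ spectrum ℝ t, 0 ≤ a := fun a ha => spectrum_star_mul_self_nonneg a ha
  have hcont : ContinuousOn (fun a : ℝ => (1 + a)⁻¹) (spectrum ℝ t) :=
    ContinuousOn.inv₀ (by fun_prop) fun a ha => by have := hpos a ha; positivity
  set r := cfc (fun a : ℝ => (1 + a)⁻¹) t with hr
  have hrsa : IsSelfAdjoint r := cfc_predicate _ _
  have hrnorm : ‖r‖ ≤ 1 := by
    refine norm_cfc_le zero_le_one fun a ha => ?_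
    have := hpos a ha
    rw [norm_inv, Real.norm_of_nonneg (by positivity)]
    exact inv_le_one_of_one_le₀ (by linarith)
  have hrt : r * (1 + t) = 1 := by
    have h1 : (1 + t) = cfc (fun a : ℝ => 1 + a) t := by
      rw [cfc_const_add (R := ℝ) 1 (fun a => a) t, cfc_id' ℝ t, map_one]
    rw [h1, hr, ← cfc_mul _ _ t hcont (by fun_prop), ← cfc_one ℝ t]
    refine cfc_congr fun a ha => ?_
    have := hpos a ha
    exact inv_mul_cancel₀ (by positivity)
  refine ⟨x * (2 * r), ?_, ?_⟩
  · have hyy : star (x * (2 * r)) * (x * (2 * r)) =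
        cfc (fun a : ℝ => 4 * ((1 + a)⁻¹ * a * (1 + a)⁻¹)) t := by
      rw [cfc_const_mul (4 : ℝ) (fun a => (1 + a)⁻¹ * a * (1 + a)⁻¹) t
          ((hcont.mul continuousOn_id).mul hcont),
        cfc_mul (fun a => (1 + a)⁻¹ * a) _ t (hcont.mul continuousOn_id) hcont,
        cfc_mul _ (fun a => a) t hcont continuousOn_id, cfc_id' ℝ t, ← hr, two_mul,
        star_mul, star_add, hrsa.star_eq]
      have : (r + r) * star x * (x * (r + r)) = (r + r) * t * (r + r) := by
        rw [ht]; simp only [mul_assoc]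
      rw [this, ← two_smul ℝ r, smul_mul_assoc, smul_mul_assoc, mul_smul_comm, smul_smul]
      norm_num
    have h : ‖star (x * (2 * r)) * (x * (2 * r))‖ ≤ 1 := by
      rw [hyy]
      refine norm_cfc_le zero_le_one fun a ha => ?_
      have := hpos a ha
      rw [Real.norm_of_nonneg (by positivity)]
      have e : 4 * ((1 + a)⁻¹ * a * (1 + a)⁻¹) = 4 * a / (1 + a) ^ 2 := by field_simp
      rw [e, div_le_one (by positivity)]
      nlinarith [sq_nonneg (1 - a)]
    rw [CStarRing.norm_star_mul_self] at h
    nlinarith [norm_nonneg (x * (2 * r))]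
  · have e : x - x * (2 * r) = x * (r * (t - 1)) := by
      have : r * (t - 1) = r * (1 + t) - 2 * r := by noncomm_ring
      rw [this, hrt, mul_sub, mul_one]
    rw [e]
    refine (twoNorm_mul_le τ _ _).trans (mul_le_mul_of_nonneg_left ?_ (norm_nonneg _))
    exact (twoNorm_mul_le τ _ _).trans
      (mul_le_of_le_one_left (twoNorm_nonneg τ _) hrnorm)

end TwoNorm

/-! ### Relations in the ultrapower, in terms of representatives -/

section Ultrapower

variable {S A : Type*} [CStarAlgebra A] (𝒰 : Ultrafilter S) (τ : FaithfulTracialState A)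

theorem mk_eq_mk_iff (x y : boundedFamilies S A) :
    (Ideal.Quotient.mk (nullIdeal 𝒰 τ) x = Ideal.Quotient.mk (nullIdeal 𝒰 τ) y) ↔
      Tendsto (fun s => twoNorm τ (x.1 s - y.1 s)) 𝒰 (𝓝 0) := by
  rw [Ideal.Quotient.eq, mem_nullIdeal]
  rfl

theorem commute_mk_iff (x y : boundedFamilies S A) :
    Commute (Ideal.Quotient.mk (nullIdeal 𝒰 τ) x) (Ideal.Quotient.mk (nullIdeal 𝒰 τ) y) ↔
      Tendsto (fun s => twoNorm τ (x.1 s * y.1 s - y.1 s * x.1 s)) 𝒰 (𝓝 0) := by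
  rw [commute_iff_eq, ← map_mul, ← map_mul, mk_eq_mk_iff]
  rfl

/-- Bounded sequences converge along an ultrafilter, so the `limUnder` that defines the trace of the
ultrapower is a limit. -/
theorem tendsto_ultraTrace_mk (x : boundedFamilies S A) :
    Tendsto (fun s => τ (x.1 s)) 𝒰
      (𝓝 (ultraTrace 𝒰 τ (Ideal.Quotient.mk (nullIdeal 𝒰 τ) x))) := by
  obtain ⟨C, hC⟩ := x.2
  have hball : ∀ s, τ (x.1 s) ∈ Metric.closedBall (0 : ℂ) C := fun s => by
    rw [mem_closedBall_zero_iff]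
    exact (norm_tr_le_norm τ _).trans (hC s)
  obtain ⟨a, -, ha⟩ := (isCompact_closedBall (0 : ℂ) C).ultrafilter_le_nhds
    (𝒰.map fun s => τ (x.1 s)) (tendsto_principal.2 (Eventually.of_forall hball))
  exact tendsto_nhds_limUnder ⟨a, ha⟩

theorem ultraTrace_mk_eq_zero_iff (x : boundedFamilies S A) :
    ultraTrace 𝒰 τ (Ideal.Quotient.mk (nullIdeal 𝒰 τ) x) = 0 ↔
      Tendsto (fun s => ‖τ (x.1 s)‖) 𝒰 (𝓝 0) := by
  rw [← tendsto_zero_iff_norm_tendsto_zero]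
  constructor
  · intro h
    simpa [h] using tendsto_ultraTrace_mk 𝒰 τ x
  · exact fun h => tendsto_nhds_unique (tendsto_ultraTrace_mk 𝒰 τ x) h

theorem isHaarUnitary_mk_iff (x : boundedFamilies S A) :
    IsHaarUnitary (ultraTrace 𝒰 τ) (Ideal.Quotient.mk (nullIdeal 𝒰 τ) x) ↔
      Tendsto (fun s => twoNorm τ (star (x.1 s) * x.1 s - 1)) 𝒰 (𝓝 0) ∧
      Tendsto (fun s => twoNorm τ (x.1 s * star (x.1 s) - 1)) 𝒰 (𝓝 0) ∧
      ∀ n : ℕ, 1 ≤ n → Tendsto (fun s => ‖τ (x.1 s ^ n)‖) 𝒰 (𝓝 0) := by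
  have hstar : star (Ideal.Quotient.mk (nullIdeal 𝒰 τ) x) =
    Ideal.Quotient.mk (nullIdeal 𝒰 τ) (star x) := rfl
  rw [IsHaarUnitary, Unitary.mem_iff, hstar, ← map_mul, ← map_mul,
    ← map_one (Ideal.Quotient.mk (nullIdeal 𝒰 τ)), mk_eq_mk_iff, mk_eq_mk_iff, and_assoc]
  refine and_congr Iff.rfl (and_congr Iff.rfl (forall₂_congr fun n _ => ?_))
  rw [← map_pow, ultraTrace_mk_eq_zero_iff]
  rfl

theorem isHaarUnitary_diag {u : A} (hu : IsHaarUnitary τ u) :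
    IsHaarUnitary (ultraTrace 𝒰 τ) (diag 𝒰 τ u) := by
  obtain ⟨h, hn⟩ := hu
  rw [Unitary.mem_iff] at h
  refine (isHaarUnitary_mk_iff 𝒰 τ _).2 ⟨?_, ?_, fun n h1 => ?_⟩
  · simp [h.1, twoNorm_zero]
  · simp [h.2, twoNorm_zero]
  · simp [hn n h1]

/-- A Haar unitary of the ultrapower is represented by a family of contractions. -/
theorem IsHaarUnitary.exists_norm_le_one {w : Ultrapower 𝒰 τ}
    (hw : IsHaarUnitary (ultraTrace 𝒰 τ) w) :
    ∃ x : boundedFamilies S A, (∀ s, ‖x.1 s‖ ≤ 1) ∧ Ideal.Quotient.mk (nullIdeal 𝒰 τ) x = w := by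
  obtain ⟨x, rfl⟩ := Ideal.Quotient.mk_surjective w
  have h1 := ((isHaarUnitary_mk_iff 𝒰 τ x).1 hw).1
  obtain ⟨C, hC⟩ := x.2
  choose y hy hxy using fun s => exists_norm_le_one_twoNorm_sub_le τ (x.1 s)
  refine ⟨⟨y, 1, hy⟩, hy, Eq.symm ((mk_eq_mk_iff 𝒰 τ _ _).2 ?_)⟩
  refine squeeze_zero (fun s => twoNorm_nonneg τ _) (fun s => (hxy s).trans
    (mul_le_mul_of_nonneg_right (hC s) (twoNorm_nonneg τ _))) ?_
  simpa using h1.const_mul C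

theorem IsCountablyCofinal.exists_tendsto_atTop {𝒰 : Ultrafilter S} (h : IsCountablyCofinal 𝒰) :
    ∃ f : S → ℕ, Tendsto f 𝒰 atTop := by
  classical
  obtain ⟨B, hB, hempty⟩ := h
  have hex : ∀ s, ∃ n, s ∉ B n := fun s => by
    by_contra! hs
    exact (hempty ▸ Set.mem_iInter.2 hs : s ∈ (∅ : Set S))
  refine ⟨fun s => Nat.find (hex s), tendsto_atTop.2 fun m => ?_⟩
  have : ∀ᶠ s in (𝒰 : Filter S), ∀ n ∈ Finset.range m, s ∈ B n :=
    (Finset.eventually_all _).2 fun n _ => hB n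
  filter_upwards [this] with s hs
  exact (Nat.le_find_iff _ _).2 fun n hn => not_not.2 (hs n (Finset.mem_range.2 hn))

end Ultrapower

/-! ### Approximate paths -/

section Paths

variable {S A : Type*} [CStarAlgebra A] (𝒰 : Ultrafilter S) (τ : FaithfulTracialState A)

/-- The tuple `x` of contractions of `A` is a commutator path from `u` to `v` up to `ε`: all the
relations hold up to `ε`, the vanishing of the trace being required of the powers up to `m` only. -/
structure IsApproxPath {k : ℕ} (u v : A) (ε : ℝ) (m : ℕ) (x : Fin (k + 1) → A) : Prop where
  norm_le_one : ∀ i, ‖x i‖ ≤ 1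
  star_mul_self : ∀ i, twoNorm τ (star (x i) * x i - 1) < ε
  mul_star_self : ∀ i, twoNorm τ (x i * star (x i) - 1) < ε
  trace_pow : ∀ i, ∀ n ∈ Finset.Icc 1 m, ‖τ (x i ^ n)‖ < ε
  left : twoNorm τ (x 0 - u) < ε
  right : twoNorm τ (x (Fin.last k) - v) < ε
  commutator : ∀ i : Fin k,
    twoNorm τ (x i.castSucc * x i.succ - x i.succ * x i.castSucc) < ε

variable {𝒰 τ}

theorem HasPath.exists_isApproxPath {u v : HaarUnitaries τ} {k : ℕ} (h : HasPath 𝒰 τ u v k)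
    {ε : ℝ} (hε : 0 < ε) (m : ℕ) :
    ∃ x : Fin (k + 1) → A, IsApproxPath τ u.1 v.1 ε m x := by
  obtain ⟨w, hw, h0, hl, hc⟩ := h
  choose x hx hxw using fun i => (hw i).exists_norm_le_one 𝒰 τ
  obtain rfl : (fun i => Ideal.Quotient.mk (nullIdeal 𝒰 τ) (x i)) = w := funext hxw
  have hH := fun i => (isHaarUnitary_mk_iff 𝒰 τ (x i)).1 (hw i)
  have e1 := eventually_all.2 fun i => (hH i).1.eventually_lt_const hε
  have e2 := eventually_all.2 fun i => (hH i).2.1.eventually_lt_const hε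
  have e3 : ∀ᶠ s in (𝒰 : Filter S), ∀ i, ∀ n ∈ Finset.Icc 1 m, ‖τ ((x i).1 s ^ n)‖ < ε :=
    eventually_all.2 fun i => (Finset.eventually_all _).2 fun n hn =>
      ((hH i).2.2 n (Finset.mem_Icc.1 hn).1).eventually_lt_const hε
  have e4 := ((mk_eq_mk_iff 𝒰 τ _ _).1 h0).eventually_lt_const hε
  have e5 := ((mk_eq_mk_iff 𝒰 τ _ _).1 hl).eventually_lt_const hε
  have e6 := eventually_all.2 fun i =>
    ((commute_mk_iff 𝒰 τ _ _).1 (hc i)).eventually_lt_const hε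
  obtain ⟨s, h1, h2, h3, h4, h5, h6⟩ :=
    (e1.and (e2.and (e3.and (e4.and (e5.and e6))))).exists
  exact ⟨fun i => (x i).1 s, fun i => hx i s, h1, h2, h3, h4, h5, h6⟩

theorem HasPath.of_isApproxPath (h𝒰 : IsCountablyCofinal 𝒰) {u v : HaarUnitaries τ} {k : ℕ}
    (h : ∀ ε > 0, ∀ m, ∃ x : Fin (k + 1) → A, IsApproxPath τ u.1 v.1 ε m x) :
    HasPath 𝒰 τ u v k := by
  obtain ⟨f, hf⟩ := h𝒰.exists_tendsto_atTop
  choose x hx using fun m : ℕ => h (1 / ((m : ℝ) + 1)) (by positivity) m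
  have hε : Tendsto (fun s => 1 / ((f s : ℝ) + 1)) 𝒰 (𝓝 0) :=
    tendsto_one_div_add_atTop_nhds_zero_nat.comp hf
  let y : Fin (k + 1) → boundedFamilies S A := fun i =>
    ⟨fun s => x (f s) i, 1, fun s => (hx (f s)).norm_le_one i⟩
  refine ⟨fun i => Ideal.Quotient.mk (nullIdeal 𝒰 τ) (y i),
    fun i => (isHaarUnitary_mk_iff 𝒰 τ (y i)).2 ⟨?_, ?_, fun n hn => ?_⟩,
    (mk_eq_mk_iff 𝒰 τ _ _).2 ?_, (mk_eq_mk_iff 𝒰 τ _ _).2 ?_,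
    fun i => (commute_mk_iff 𝒰 τ _ _).2 ?_⟩
  · exact squeeze_zero (fun s => twoNorm_nonneg τ _)
      (fun s => ((hx (f s)).star_mul_self i).le) hε
  · exact squeeze_zero (fun s => twoNorm_nonneg τ _)
      (fun s => ((hx (f s)).mul_star_self i).le) hε
  · refine squeeze_zero' (Eventually.of_forall fun s => norm_nonneg _) ?_ hε
    filter_upwards [hf.eventually_ge_atTop n] with s hs
    exact ((hx (f s)).trace_pow i n (Finset.mem_Icc.2 ⟨hn, hs⟩)).le
  · exact squeeze_zero (fun s => twoNorm_nonneg τ _) (fun s => (hx (f s)).left.le) hε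
  · exact squeeze_zero (fun s => twoNorm_nonneg τ _) (fun s => (hx (f s)).right.le) hε
  · exact squeeze_zero (fun s => twoNorm_nonneg τ _) (fun s => ((hx (f s)).commutator i).le) hε

/-- The existence of a path with `k` steps in the ultrapower does not depend on the ultrafilter: it
says that there are arbitrarily good approximate paths in `A`. -/
theorem hasPath_iff_approxPath (h𝒰 : IsCountablyCofinal 𝒰) {u v : HaarUnitaries τ} {k : ℕ} :
    HasPath 𝒰 τ u v k ↔
      ∀ ε > 0, ∀ m, ∃ x : Fin (k + 1) → A, IsApproxPath τ u.1 v.1 ε m x :=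
  ⟨fun h _ hε m => h.exists_isApproxPath hε m, HasPath.of_isApproxPath h𝒰⟩

theorem IsApproxPath.of_twoNorm_sub_lt {k : ℕ} {u v u' v' : A} {ε δ : ℝ} {m : ℕ}
    {x : Fin (k + 1) → A} (h : IsApproxPath τ u' v' ε m x) (hu : twoNorm τ (u' - u) < δ)
    (hv : twoNorm τ (v' - v) < δ) : IsApproxPath τ u v (ε + δ) m x := by
  have hle : ε ≤ ε + δ := le_add_of_nonneg_right ((twoNorm_nonneg τ _).trans hu.le)
  refine ⟨h.norm_le_one, fun i => (h.star_mul_self i).trans_le hle,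
    fun i => (h.mul_star_self i).trans_le hle, fun i n hn => (h.trace_pow i n hn).trans_le hle,
    ?_, ?_, fun i => (h.commutator i).trans_le hle⟩
  · rw [← sub_add_sub_cancel _ u']
    exact (twoNorm_add_le τ _ _).trans_lt (add_lt_add h.left hu)
  · rw [← sub_add_sub_cancel _ v']
    exact (twoNorm_add_le τ _ _).trans_lt (add_lt_add h.right hv)

theorem isClosed_setOf_hasPath [TopologicalSpace (HaarUnitaries τ)]
    (hball : ∀ u : HaarUnitaries τ, ∀ ε > 0, ∀ᶠ v in 𝓝 u, twoNorm τ (v.1 - u.1) < ε)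
    (h𝒰 : IsCountablyCofinal 𝒰) (k : ℕ) :
    IsClosed {x : HaarUnitaries τ × HaarUnitaries τ | HasPath 𝒰 τ x.1 x.2 k} := by
  refine isClosed_of_closure_subset ?_
  rintro ⟨u, v⟩ hx
  refine (hasPath_iff_approxPath h𝒰).2 fun ε hε m => ?_
  obtain ⟨⟨u', v'⟩, ⟨hu, hv⟩, h⟩ := mem_closure_iff_nhds.1 hx _
    (prod_mem_nhds (hball u (ε / 2) (half_pos hε)) (hball v (ε / 2) (half_pos hε)))
  obtain ⟨x, hx⟩ := HasPath.exists_isApproxPath h (half_pos hε) m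
  exact ⟨x, add_halves ε ▸ hx.of_twoNorm_sub_lt hu hv⟩

/-! ### Path length and sequential commutation -/

theorem HasPath.succ {u v : HaarUnitaries τ} {k : ℕ} (h : HasPath 𝒰 τ u v k) :
    HasPath 𝒰 τ u v (k + 1) := by
  obtain ⟨w, hw, h0, hl, hc⟩ := h
  refine ⟨Fin.snoc w (w (Fin.last k)), ?_, ?_, ?_, ?_⟩
  · refine Fin.lastCases ?_ fun i => ?_
    · simpa using hw _
    · simpa using hw i
  · rw [← Fin.castSucc_zero, Fin.snoc_castSucc, h0]
  · rw [Fin.snoc_last, hl]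
  · refine Fin.lastCases ?_ fun i => ?_
    · rw [Fin.succ_last, Fin.snoc_last, Fin.snoc_castSucc]
    · rw [Fin.snoc_castSucc, Fin.succ_castSucc, Fin.snoc_castSucc]
      exact hc i

theorem HasPath.mono {u v : HaarUnitaries τ} {k l : ℕ} (h : HasPath 𝒰 τ u v k) (hkl : k ≤ l) :
    HasPath 𝒰 τ u v l := by
  induction l, hkl using Nat.le_induction with
  | base => exact h
  | succ l _ ih => exact ih.succ

theorem pathLength_le_iff {u v : HaarUnitaries τ} {k : ℕ} :
    pathLength 𝒰 τ u v ≤ k ↔ HasPath 𝒰 τ u v k := by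
  refine ⟨fun h => ?_, fun h => iInf₂_le k h⟩
  have h' : pathLength 𝒰 τ u v < (k + 1 : ℕ) := h.trans_lt (by exact_mod_cast k.lt_succ_self)
  simp only [pathLength, iInf_lt_iff] at h'
  obtain ⟨l, hl, hlt⟩ := h'
  exact hl.mono (Nat.lt_succ_iff.1 (by exact_mod_cast hlt))

theorem HasPath.symm {u v : HaarUnitaries τ} {k : ℕ} (h : HasPath 𝒰 τ u v k) :
    HasPath 𝒰 τ v u k := by
  obtain ⟨w, hw, h0, hl, hc⟩ := h
  refine ⟨w ∘ Fin.rev, fun i => hw _, by simpa using hl, by simpa using h0, fun i => ?_⟩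
  simpa [Fin.rev_castSucc, Fin.rev_succ] using (hc i.rev).symm

theorem HasPath.trans {u v z : HaarUnitaries τ} {k l : ℕ} (h : HasPath 𝒰 τ u v k)
    (h' : HasPath 𝒰 τ v z l) : HasPath 𝒰 τ u z (k + l) := by
  obtain ⟨w, hw, h0, hl, hc⟩ := h
  obtain ⟨w', hw', h0', hl', hc'⟩ := h'
  refine ⟨fun i => if h : i.1 ≤ k then w ⟨i.1, by omega⟩ else w' ⟨i.1 - k, by omega⟩,
    fun i => ?_, ?_, ?_, fun i => ?_⟩
  · dsimp only
    split_ifs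
    exacts [hw _, hw' _]
  · simpa using h0
  · rcases Nat.eq_zero_or_pos l with rfl | hpos
    · simpa [Fin.last] using (hl.trans h0'.symm).trans hl'
    · simpa [hpos.ne', Fin.last] using hl'
  · rcases lt_trichotomy i.1 k with hi | hi | hi
    · simpa [hi.le, Nat.succ_le_iff.2 hi] using hc ⟨i.1, hi⟩
    · -- the junction of the two paths, where `w k = v = w' 0`
      have h := hc' ⟨0, by omega⟩
      have e : w' (Fin.castSucc ⟨0, by omega⟩) = w ⟨k, by omega⟩ := h0'.trans hl.symm
      rw [e] at h
      simpa [hi] using h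
    · have h := hc' ⟨i.1 - k, by omega⟩
      have e : i.1 + 1 - k = i.1 - k + 1 := by omega
      simpa [hi.not_ge, (hi.trans (Nat.lt_succ_self _)).not_ge, e] using h

theorem seqCommute_iff_exists_hasPath {u v : HaarUnitaries τ} :
    SeqCommute 𝒰 τ u v ↔ ∃ k, HasPath 𝒰 τ u v k := by
  constructor
  · rintro ⟨n, w, hw, h0, hc, hl⟩
    refine ⟨n + 2, Fin.cons (diag 𝒰 τ u.1) (Fin.snoc w (diag 𝒰 τ v.1)), ?_, ?_, ?_, ?_⟩
    · refine Fin.cases ?_ (Fin.lastCases ?_ fun i => ?_)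
      · simpa using isHaarUnitary_diag 𝒰 τ u.2
      · simpa using isHaarUnitary_diag 𝒰 τ v.2
      · simpa using hw i
    · simp
    · rw [← Fin.succ_last, Fin.cons_succ, Fin.snoc_last]
    · refine Fin.cases ?_ (Fin.lastCases ?_ fun i => ?_)
      · rw [Fin.castSucc_zero, Fin.cons_zero, Fin.cons_succ, ← Fin.castSucc_zero,
          Fin.snoc_castSucc]
        exact h0
      · rw [← Fin.succ_castSucc, Fin.cons_succ, Fin.cons_succ, Fin.snoc_castSucc,
          Fin.succ_last, Fin.snoc_last]
        exact hl
      · rw [← Fin.succ_castSucc, Fin.cons_succ, Fin.cons_succ, Fin.snoc_castSucc,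
          Fin.succ_castSucc, Fin.snoc_castSucc]
        exact hc i
  · rintro ⟨k, w, hw, h0, hl, hc⟩
    exact ⟨k, w, hw, by rw [h0], hc, by rw [hl]⟩

theorem equivalence_seqCommute : Equivalence (SeqCommute 𝒰 τ) where
  refl u := seqCommute_iff_exists_hasPath.2
    ⟨0, fun _ => diag 𝒰 τ u.1, fun _ => isHaarUnitary_diag 𝒰 τ u.2, rfl, rfl, fun i => i.elim0⟩
  symm h := by
    obtain ⟨k, hk⟩ := seqCommute_iff_exists_hasPath.1 h
    exact seqCommute_iff_exists_hasPath.2 ⟨k, hk.symm⟩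
  trans h h' := by
    obtain ⟨k, hk⟩ := seqCommute_iff_exists_hasPath.1 h
    obtain ⟨l, hl⟩ := seqCommute_iff_exists_hasPath.1 h'
    exact seqCommute_iff_exists_hasPath.2 ⟨k + l, hk.trans hl⟩

theorem SeqCommute.pathLength_le_commutationDiameter {u v : HaarUnitaries τ}
    (h : SeqCommute 𝒰 τ u v) : pathLength 𝒰 τ u v ≤ commutationDiameter 𝒰 τ := by
  refine le_trans ?_ (le_iSup (fun z => orbitDiameter 𝒰 τ (orbit 𝒰 τ z)) u)
  exact le_iSup₂_of_le u (equivalence_seqCommute.refl u)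
    (le_iSup₂_of_le v (equivalence_seqCommute.symm h) le_rfl)

/-! ### The two topologies -/

theorem eventually_twoNorm_sub_lt_twoNormTopology (u : HaarUnitaries τ) {ε : ℝ} (hε : 0 < ε) :
    ∀ᶠ v in @nhds _ (twoNormTopology τ) u, twoNorm τ (v.1 - u.1) < ε := by
  let _ := twoNormTopology τ
  refine IsOpen.mem_nhds (s := {v : HaarUnitaries τ | twoNorm τ (v.1 - u.1) < ε}) ?_ ?_
  · intro v hv
    refine ⟨ε - twoNorm τ (v.1 - u.1), sub_pos.2 hv, fun z hz => ?_⟩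
    change twoNorm τ (z.1 - u.1) < ε
    rw [← sub_add_sub_cancel _ v.1]
    exact (twoNorm_add_le τ _ _).trans_lt (by linarith)
  · change twoNorm τ (u.1 - u.1) < ε
    rwa [sub_self, twoNorm_zero]

end Paths

section VN

variable {H : Type*} [NormedAddCommGroup H] [InnerProductSpace ℂ H] [CompleteSpace H]

theorem IsNormal.exists_hasSum_star_mul_self {M : VonNeumannAlgebra H}
    {τ : FaithfulTracialState M.toStarSubalgebra} (hτ : IsNormal M τ) :
    ∃ ξ η : ℕ → H, Summable (fun n => ‖ξ n‖ ^ 2) ∧ Summable (fun n => ‖η n‖ ^ 2) ∧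
      ∀ x : M.toStarSubalgebra, HasSum
        (fun n => inner ℂ ((x : H →L[ℂ] H) (ξ n)) ((x : H →L[ℂ] H) (η n))) (τ (star x * x)) := by
  obtain ⟨ξ, η, hξ, hη, hsum⟩ := hτ
  refine ⟨ξ, η, hξ, hη, fun x => (hsum (star x * x)).congr_fun fun n => ?_⟩
  exact (ContinuousLinearMap.adjoint_inner_right (x : H →L[ℂ] H) (ξ n) _).symm

/-- By normality `‖v - u‖₂² = ∑ₙ ⟪(v - u) ξₙ, (v - u) ηₙ⟫`, and the `n`-th term is at most
`4 ‖ξₙ‖ ‖ηₙ‖`, since `‖v - u‖ ≤ 2`. -/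
theorem eventually_twoNorm_sub_lt_strongOperatorTopology {M : VonNeumannAlgebra H}
    {τ : FaithfulTracialState M.toStarSubalgebra} (hτ : IsNormal M τ) (u : HaarUnitaries τ)
    {ε : ℝ} (hε : 0 < ε) :
    ∀ᶠ v in @nhds _ (strongOperatorTopology M τ) u, twoNorm τ (v.1 - u.1) < ε := by
  let _ := strongOperatorTopology M τ
  obtain ⟨ξ, η, hξ, hη, hsum⟩ := hτ.exists_hasSum_star_mul_self
  have hev : ∀ ζ : H, Continuous fun v : HaarUnitaries τ => (v.1 : H →L[ℂ] H) ζ := fun ζ =>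
    (continuous_apply ζ).comp continuous_induced_dom
  have hnorm : ∀ v : HaarUnitaries τ, ‖(v.1 : H →L[ℂ] H)‖ ≤ 1 := fun v => by
    rcases subsingleton_or_nontrivial M.toStarSubalgebra
    · rw [Subsingleton.elim v.1 0]
      simp
    · exact (CStarRing.norm_of_mem_unitary (E := M.toStarSubalgebra) v.2.1).le
  have hdiff : ∀ (v : HaarUnitaries τ) (ζ : H),
      ‖(v.1 : H →L[ℂ] H) ζ - (u.1 : H →L[ℂ] H) ζ‖ ≤ 2 * ‖ζ‖ := fun v ζ => by
    have h1 := (v.1 : H →L[ℂ] H).le_of_opNorm_le (hnorm v) ζ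
    have h2 := (u.1 : H →L[ℂ] H).le_of_opNorm_le (hnorm u) ζ
    linarith [norm_sub_le ((v.1 : H →L[ℂ] H) ζ) ((u.1 : H →L[ℂ] H) ζ)]
  have htsum : ∀ v : HaarUnitaries τ, τ (star (v.1 - u.1) * (v.1 - u.1)) =
      ∑' n, inner ℂ ((v.1 : H →L[ℂ] H) (ξ n) - (u.1 : H →L[ℂ] H) (ξ n))
        ((v.1 : H →L[ℂ] H) (η n) - (u.1 : H →L[ℂ] H) (η n)) := fun v =>
    (hsum (v.1 - u.1)).tsum_eq.symm
  have hsummable : Summable fun n => 2 * (‖ξ n‖ ^ 2 + ‖η n‖ ^ 2) := (hξ.add hη).mul_left 2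
  have hcont : Continuous fun v : HaarUnitaries τ => τ (star (v.1 - u.1) * (v.1 - u.1)) := by
    simp_rw [htsum]
    refine continuous_tsum (fun n => ((hev _).sub continuous_const).inner
      ((hev _).sub continuous_const)) hsummable fun n v => ?_
    refine (norm_inner_le_norm _ _).trans
      ((mul_le_mul (hdiff v _) (hdiff v _) (norm_nonneg _) (by positivity)).trans ?_)
    nlinarith [sq_nonneg (‖ξ n‖ - ‖η n‖)]
  have hcont' : Continuous fun v : HaarUnitaries τ => twoNorm τ (v.1 - u.1) :=
    (Complex.continuous_re.comp hcont).sqrt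
  refine hcont'.continuousAt.eventually_lt_const ?_
  change twoNorm τ (u.1 - u.1) < ε
  rwa [sub_self, twoNorm_zero]

end VN

end TracialVN

theorem mainTheorem8 {H : Type*} [NormedAddCommGroup H] [InnerProductSpace ℂ H] [CompleteSpace H]
    (M : VonNeumannAlgebra H) (τ : TracialVN.FaithfulTracialState M.toStarSubalgebra)
    (hτ : TracialVN.IsNormal M τ) (hM : TracialVN.IsDiffuse M)
    {S : Type*} (𝒰 : Ultrafilter S) (h𝒰 : TracialVN.IsCountablyCofinal 𝒰) :
    Equivalence (TracialVN.SeqCommute 𝒰 τ) ∧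
    ∀ t : TopologicalSpace (TracialVN.HaarUnitaries τ),
      (t = TracialVN.strongOperatorTopology M τ ∨ t = TracialVN.twoNormTopology τ) →
      (∀ k : ℕ, IsClosed {x : TracialVN.HaarUnitaries τ × TracialVN.HaarUnitaries τ |
        TracialVN.pathLength 𝒰 τ x.1 x.2 ≤ k}) ∧
      TracialVN.IsFSigma {x : TracialVN.HaarUnitaries τ × TracialVN.HaarUnitaries τ |
        TracialVN.SeqCommute 𝒰 τ x.1 x.2} ∧
      @MeasurableSet _ (borel (TracialVN.HaarUnitaries τ × TracialVN.HaarUnitaries τ))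
        {x : TracialVN.HaarUnitaries τ × TracialVN.HaarUnitaries τ |
          TracialVN.SeqCommute 𝒰 τ x.1 x.2} ∧
      (TracialVN.commutationDiameter 𝒰 τ < ⊤ →
        IsClosed {x : TracialVN.HaarUnitaries τ × TracialVN.HaarUnitaries τ |
          TracialVN.SeqCommute 𝒰 τ x.1 x.2}) := by
  have hunion : {x : TracialVN.HaarUnitaries τ × TracialVN.HaarUnitaries τ |
      TracialVN.SeqCommute 𝒰 τ x.1 x.2} =
      ⋃ k : ℕ, {x | TracialVN.HasPath 𝒰 τ x.1 x.2 k} := by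
    ext x
    simp [TracialVN.seqCommute_iff_exists_hasPath]
  refine ⟨TracialVN.equivalence_seqCommute, fun t ht => ?_⟩
  have hclosed : ∀ k : ℕ, IsClosed {x : TracialVN.HaarUnitaries τ × TracialVN.HaarUnitaries τ |
      TracialVN.HasPath 𝒰 τ x.1 x.2 k} := by
    refine TracialVN.isClosed_setOf_hasPath (fun u ε hε => ?_) h𝒰
    rcases ht with rfl | rfl
    · exact TracialVN.eventually_twoNorm_sub_lt_strongOperatorTopology hτ u hε
    · exact TracialVN.eventually_twoNorm_sub_lt_twoNormTopology u hε
  refine ⟨fun k => ?_, ⟨_, hclosed, hunion⟩, ?_, fun hfin => ?_⟩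
  · simpa only [TracialVN.pathLength_le_iff] using hclosed k
  · borelize (TracialVN.HaarUnitaries τ × TracialVN.HaarUnitaries τ)
    rw [hunion]
    exact MeasurableSet.iUnion fun k => (hclosed k).measurableSet
  · obtain ⟨K, hK⟩ := ENat.ne_top_iff_exists.1 hfin.ne
    convert hclosed K using 3 with x
    rw [TracialVN.seqCommute_iff_exists_hasPath]
    refine ⟨fun h => TracialVN.pathLength_le_iff.1 ?_, fun h => ⟨K, h⟩⟩
    rw [hK]
    exact (TracialVN.seqCommute_iff_exists_hasPath.2 h).pathLength_le_commutationDiameter
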